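/- Let $\mathbf{F}_q$ be a finite field with $q$ elements, $K=\mathbf{F}_q((T))$ with the absolute value $|x|=q^{-v(x)}$ ($v$ the $T$-adic valuation, $|0|=0$), $O=\mathbf{F}_q[[T]]$, and let $C(O,K)$ be the $K$-Banach space of continuous functions $O\to K$ with the sup-norm. A sequence $\{f_j\}_{j\ge 0}$ in $C(O,K)$ is called an orthonormal basis if every $f\in C(O,K)$ has a unique expansion $f=\sum_{j\ge 0}a_jf_j$ (convergent in norm) with $a_j\in K$, $a_j\to 0$, and for this expansion $\|f\|=\max_j|a_j|$. Put $[n]=T^{q^n}-T$, $F_0=1$, $F_n=[n][n-1]^q\cdots[1]^{q^{n-1}}$ for $n\ge1$, and $$E_n(x)=\frac{1}{F_n}\prod_{\substack{m\in\mathbf{F}_q[T]\\ \deg m<n}}(x-m)\qquad(n\ge 0,\ \deg 0=-\infty,\text{ so } E_0(x)=x).$$ Let $\mathcal{D}_n$ be the Hasse derivative $\mathcal{D}_n(\sum_i a_iT^i)=\sum_i\binom{i}{n}a_iT^{i-n}$. For an integer $j\ge 0$ with $q$-adic expansion $j=\alpha_0+\alpha_1q+\cdots+\alpha_sq^s$,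 $0\le\alpha_i<q$, define the Carlitz polynomial $G_j$, the digit derivative $D_j$ and the function $D'_j$ (with pointwise products and powers) by $$G_j=\prod_{i=0}^sE_i^{\alpha_i},\qquad D_j=\prod_{i=0}^s\mathcal{D}_i^{\alpha_i},\qquad D'_j=\prod_{i=0}^sD'_{\alpha_iq^i},\qquad D'_{\alpha q^i}=\begin{cases}\mathcal{D}_i^{\alpha}&\text{if }0\le\alpha<q-1,\\ \mathcal{D}_i^{\alpha}-1&\text{if }\alpha=q-1,\end{cases}$$ so that $G_0=D_0=D'_0=1$. (1) Both $\{G_j\}_{j\ge0}$ and $\{D_j\}_{j\ge0}$ are orthonormal bases of $C(O,K)$. (2) If $f\in C(O,K)$ is written as $f=\sum_{j\ge0}B_jD_j$ with $B_j\in K$, then for every $j\ge 0$ and every integer $n\ge0$ with $q^n>j$, $$B_j=(-1)^n\sum_{\substack{m\in\mathbf{F}_q[T]\\ \deg m<n}}D'_{q^n-1-j}(m)\,f(m).$$ -/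

import Mathlib

open Filter Topology Finset
open scoped LaurentSeries NNReal

namespace CarlitzBases

noncomputable section

section Abstract

variable {𝕜 E : Type*} [NormedField 𝕜] [NormedAddCommGroup E] [NormedSpace 𝕜 E]

/-- `f = ∑ aⱼ eⱼ`, with convergence of the partial sums in the norm of `E`. -/
def HasExpansion (e : ℕ → E) (a : ℕ → 𝕜) (f : E) : Prop :=
  Tendsto (fun N => ∑ j ∈ range N, a j • e j) atTop (𝓝 f)

/-- `e` is an orthonormal basis of the normed space `E` over the (non-archimedean) field `𝕜`:
every `f` has a unique expansion `f = ∑ aⱼ eⱼ` with `aⱼ → 0`, and then `‖f‖ = max ‖aⱼ‖`. -/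
structure IsOrthonormalBasis (𝕜 : Type*) {E : Type*} [NormedField 𝕜] [NormedAddCommGroup E]
    [NormedSpace 𝕜 E] (e : ℕ → E) : Prop where
  existsUnique_expansion : ∀ f : E, ∃! a : ℕ → 𝕜, Tendsto a atTop (𝓝 0) ∧ HasExpansion e a f
  norm_eq_max : ∀ (f : E) (a : ℕ → 𝕜), Tendsto a atTop (𝓝 0) → HasExpansion e a f →
    IsGreatest (Set.range fun j => ‖a j‖) ‖f‖

end Abstract

/-- The number of elements `q` of the finite field. -/
abbrev q (F : Type*) : ℕ := Nat.card F

section AbsoluteValue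

variable (F : Type*) [Field F] [Finite F]

lemma one_lt_q : 1 < q F := Finite.one_lt_card

lemma one_lt_q_nnreal : (1 : ℝ≥0) < (q F : ℝ≥0) := by exact_mod_cast one_lt_q F

lemma q_ne_zero : (q F : ℝ≥0) ≠ 0 := (zero_lt_one.trans (one_lt_q_nnreal F)).ne'

/-- The `T`-adic valuation of `F⸨T⸩`, made real valued by sending the valuation of `T` to `q⁻¹`. -/
instance rankOne : Valuation.RankOne (Valued.v : Valuation F⸨X⸩ (WithZero (Multiplicative ℤ))) where
  hom' := (WithZeroMulInt.toNNReal (q_ne_zero F)).comp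
    (MonoidWithZeroHom.ValueGroup₀.embedding)
  strictMono' := (WithZeroMulInt.toNNReal_strictMono (one_lt_q_nnreal F)).comp
    (MonoidWithZeroHom.ValueGroup₀.embedding_strictMono)
  exists_val_nontrivial := by
    refine ⟨((PowerSeries.X : PowerSeries F) : F⸨X⸩) ^ 1, ?_⟩
    rw [LaurentSeries.valuation_X_pow]
    decide

/-- `K = F⸨T⸩` as a normed field; see `norm_eq` for the normalization of the absolute value. -/
instance normedField : NormedField F⸨X⸩ := Valued.toNormedField F⸨X⸩ (WithZero (Multiplicative ℤ))

variable {F}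

open Classical in
/-- The absolute value on `F⸨T⸩` is `|x| = q ^ (-v(x))` for `x ≠ 0`, and `|0| = 0`. -/
theorem norm_eq (x : F⸨X⸩) : ‖x‖ = if x = 0 then 0 else (q F : ℝ) ^ (-x.order) := by
  have h0 : ‖x‖ = ((WithZeroMulInt.toNNReal (q_ne_zero F) (Valued.v x) : ℝ≥0) : ℝ) := by
    conv_rhs => rw [← Valuation.embedding_restrict]
    rfl
  split_ifs with hx
  · rw [hx, norm_zero]
  have hv : (Valued.v x : WithZero (Multiplicative ℤ)) = WithZero.exp (-x.order) := by
    have hne : (Valued.v x : WithZero (Multiplicative ℤ)) ≠ 0 := by simpa using hx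
    refine le_antisymm ?_ ?_
    · rw [LaurentSeries.valuation_le_iff_coeff_lt_eq_zero]
      exact fun n hn => HahnSeries.coeff_eq_zero_of_lt_order hn
    · by_contra hlt
      rw [not_le] at hlt
      have h1 : (Valued.v x : WithZero (Multiplicative ℤ)) ≤ WithZero.exp (-(x.order + 1)) := by
        rw [← WithZero.exp_log hne] at hlt ⊢
        rw [WithZero.exp_lt_exp] at hlt
        rw [WithZero.exp_le_exp]
        omega
      rw [LaurentSeries.valuation_le_iff_coeff_lt_eq_zero] at h1
      exact HahnSeries.coeff_order_eq_zero.not.mpr hx (h1 x.order (by omega))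
  rw [h0, hv, WithZeroMulInt.toNNReal_neg_apply _ WithZero.exp_ne_zero]
  rw [NNReal.coe_zpow]
  rfl

theorem norm_le_zpow_iff (x : F⸨X⸩) (D : ℤ) :
    ‖x‖ ≤ (q F : ℝ) ^ (-D) ↔ ∀ n < D, x.coeff n = 0 := by
  have hq : (1 : ℝ) < q F := by exact_mod_cast one_lt_q F
  rw [norm_eq]
  split_ifs with hx
  · simp only [hx, HahnSeries.coeff_zero, implies_true, iff_true]
    positivity
  rw [zpow_le_zpow_iff_right₀ hq]
  constructor
  · exact fun h n hn => HahnSeries.coeff_eq_zero_of_lt_order (by omega)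
  · intro h
    by_contra hlt
    exact HahnSeries.coeff_order_eq_zero.not.mpr hx (h x.order (by omega))

/-- A map into `F⸨T⸩` is continuous if each coefficient below a given index is locally constant. -/
theorem continuous_of_coeff {Y : Type*} [TopologicalSpace Y] {g : Y → F⸨X⸩}
    (h : ∀ (y : Y) (D : ℕ), ∀ᶠ z in 𝓝 y, ∀ n : ℤ, n < D → (g z).coeff n = (g y).coeff n) :
    Continuous g := by
  have hq : (1 : ℝ) < q F := by exact_mod_cast one_lt_q F
  rw [continuous_iff_continuousAt]
  intro y
  rw [ContinuousAt, Metric.tendsto_nhds]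
  intro ε hε
  obtain ⟨D, hD⟩ := exists_pow_lt_of_lt_one hε (inv_lt_one_of_one_lt₀ hq)
  filter_upwards [h y D] with z hz
  rw [dist_eq_norm]
  refine lt_of_le_of_lt ((norm_le_zpow_iff _ (D : ℤ)).mpr ?_) ?_
  · intro n hn
    rw [HahnSeries.coeff_sub, hz n hn, sub_self]
  · rwa [zpow_neg, zpow_natCast, ← inv_pow]

theorem continuous_hasseDeriv (n : ℕ) :
    Continuous (LaurentSeries.hasseDeriv F n : F⸨X⸩ → F⸨X⸩) := by
  have hq : (1 : ℝ) < q F := by exact_mod_cast one_lt_q F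
  refine continuous_of_coeff fun y D => ?_
  filter_upwards [Metric.ball_mem_nhds y (show (0 : ℝ) < (q F : ℝ) ^ (-((D : ℤ) + n)) by positivity)]
    with z hz i hi
  rw [Metric.mem_ball, dist_eq_norm] at hz
  have := (norm_le_zpow_iff (z - y) ((D : ℤ) + n)).mp hz.le (i + n) (by omega)
  rw [HahnSeries.coeff_sub, sub_eq_zero] at this
  simp only [LaurentSeries.hasseDeriv_coeff, this]

end AbsoluteValue

section Integers

variable (F : Type*) [Field F] [Finite F]

/-- `O = F⟦T⟧`, as a subring of `K = F⸨T⸩`. -/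
abbrev O : Subring F⸨X⸩ := LaurentSeries.powerSeries_as_subring F

theorem isCompact_O : IsCompact (O F : Set F⸨X⸩) := by
  let _ : TopologicalSpace F := ⊥
  have : DiscreteTopology F := ⟨rfl⟩
  let g : (ℕ → F) → F⸨X⸩ := fun c => ((PowerSeries.mk c : PowerSeries F) : F⸨X⸩)
  have hg : Continuous g := by
    refine continuous_of_coeff fun y D => ?_
    have hev : ∀ᶠ z in 𝓝 y, ∀ i ∈ range D, z i = y i := by
      rw [eventually_all_finset]
      intro i _
      exact (continuous_apply i).continuousAt.eventually
        (isOpen_discrete ({y i} : Set F) |>.mem_nhds rfl)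
    filter_upwards [hev] with z hz n hn
    simp only [g, PowerSeries.coeff_coe]
    split_ifs with h
    · rfl
    · simp only [PowerSeries.coeff_mk]
      exact hz _ (by rw [mem_range]; omega)
  have hr : (O F : Set F⸨X⸩) = Set.range g := by
    ext x
    constructor
    · rintro ⟨p, -, rfl⟩
      refine ⟨fun n => PowerSeries.coeff n p, ?_⟩
      simp only [g]
      congr 1
      ext n
      simp
    · rintro ⟨c, rfl⟩
      exact ⟨PowerSeries.mk c, trivial, rfl⟩
  rw [hr]
  exact isCompact_range hg

/-- `O` is compact, so that `C(O F, F⸨X⸩)` carries the supremum norm. -/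
instance compactSpace_O : CompactSpace (O F) := isCompact_iff_compactSpace.mp (isCompact_O F)

variable {F}

/-- A polynomial in `F[T]` as an element of `O = F⟦T⟧`. -/
def polyO (m : Polynomial F) : O F :=
  ⟨((m : PowerSeries F) : F⸨X⸩), ⟨(m : PowerSeries F), trivial, rfl⟩⟩

variable (F)

theorem finite_degree_lt (n : ℕ) : {m : Polynomial F | m.degree < n}.Finite := by
  have : Finite (Polynomial.degreeLT F n) :=
    Finite.of_equiv _ (Polynomial.degreeLTEquiv F n).symm.toEquiv
  exact (Set.toFinite (Polynomial.degreeLT F n : Set (Polynomial F))).subset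
    fun m hm => Polynomial.mem_degreeLT.mpr hm

/-- The finite set of all polynomials `m ∈ F[T]` with `deg m < n` (with `deg 0 = -∞`). -/
def polysLT (n : ℕ) : Finset (Polynomial F) := (finite_degree_lt F n).toFinset

@[simp]
theorem mem_polysLT {n : ℕ} {m : Polynomial F} : m ∈ polysLT F n ↔ m.degree < n := by
  simp [polysLT]

end Integers

section Bases

variable (F : Type*) [Field F] [Finite F]

/-- The variable `T` of `K = F⸨T⸩`. -/
def T : F⸨X⸩ := ((PowerSeries.X : PowerSeries F) : F⸨X⸩)

/-- `[n] = T ^ (q ^ n) - T`. -/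
def bracket (n : ℕ) : F⸨X⸩ := T F ^ q F ^ n - T F

/-- `Fₙ = [n] [n-1]^q ⋯ [1]^(q^(n-1))`, with `F₀ = 1`. -/
def carlitzF (n : ℕ) : F⸨X⸩ := ∏ i ∈ range n, bracket F (n - i) ^ q F ^ i

/-- `eₙ(x) = ∏_{deg m < n} (x - m)`, as a polynomial over `K`; in particular `e₀(x) = x`. -/
def carlitzLittleE (n : ℕ) : Polynomial F⸨X⸩ :=
  ∏ m ∈ polysLT F n, (Polynomial.X - Polynomial.C (polyO m : F⸨X⸩))

/-- `Eₙ(x) = eₙ(x) / Fₙ`. -/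
def carlitzE (n : ℕ) : Polynomial F⸨X⸩ :=
  Polynomial.C (carlitzF F n)⁻¹ * carlitzLittleE F n

/-- The number `s + 1` of digits of `j = α₀ + α₁ q + ⋯ + αₛ q^s` in base `q` (`0` for `j = 0`). -/
def numDigits (j : ℕ) : ℕ := (Nat.digits (q F) j).length

/-- The digit `αᵢ` of `j` in base `q`. -/
def digit (j i : ℕ) : ℕ := j / q F ^ i % q F

/-- The Carlitz polynomial `Gⱼ(x) = ∏ᵢ Eᵢ(x) ^ αᵢ`. -/
def carlitzG (j : ℕ) : Polynomial F⸨X⸩ :=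
  ∏ i ∈ range (numDigits F j), carlitzE F i ^ digit F j i

/-- The Carlitz polynomial `Gⱼ` as a continuous function `O → K`. -/
def carlitzGFun (j : ℕ) : C(O F, F⸨X⸩) where
  toFun x := (carlitzG F j).eval (x : F⸨X⸩)
  continuous_toFun := (carlitzG F j).continuous.comp continuous_subtype_val

/-- The hyper-differential operator (Hasse derivative) `𝒟ₙ(∑ aᵢ Tⁱ) = ∑ (i choose n) aᵢ Tⁱ⁻ⁿ` as a
continuous function `O → K`. -/
def hyperDeriv (n : ℕ) : C(O F, F⸨X⸩) where
  toFun x := LaurentSeries.hasseDeriv F n (x : F⸨X⸩)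
  continuous_toFun := (continuous_hasseDeriv n).comp continuous_subtype_val

/-- The digit derivative `Dⱼ = ∏ᵢ 𝒟ᵢ ^ αᵢ` (pointwise products and powers). -/
def digitDeriv (j : ℕ) : C(O F, F⸨X⸩) :=
  ∏ i ∈ range (numDigits F j), hyperDeriv F i ^ digit F j i

/-- `D'_{α qⁱ}`, which is `𝒟ᵢ ^ α` for `α < q - 1` and `𝒟ᵢ ^ α - 1` for `α = q - 1`. -/
def digitDerivFactor' (α i : ℕ) : C(O F, F⸨X⸩) :=
  if α = q F - 1 then hyperDeriv F i ^ α - 1 else hyperDeriv F i ^ α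

/-- `D'ⱼ = ∏ᵢ D'_{αᵢ qⁱ}`. -/
def digitDeriv' (j : ℕ) : C(O F, F⸨X⸩) :=
  ∏ i ∈ range (numDigits F j), digitDerivFactor' F (digit F j i) i

end Bases

end

end CarlitzBases

open CarlitzBases

/-!
Both families `𝒟ᵢ` and `Eᵢ` behave like the `i`-th digit function `∑ aₖ Tᵏ ↦ aᵢ`: they are additive,
vanish on polynomials of degree `< i`, take the value `a` at `a Tⁱ`, and contract `Tⁱ O` as division
by `Tⁱ` does (`IsDigitFamily`). Everything in the theorem follows from these properties of the
factors `gᵢ`, for the products `Dⱼ = ∏ᵢ gᵢ ^ αᵢ` (`digitProd`) and `D'ⱼ` (`dualProd`).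

*Duality.* In `∑_{deg m < n} D'_{q^n-1-j}(m) Dₖ(m)`, write `m = m' + a T^(n-1)` and induct on `n`. The
coefficient `a` enters the factors of lower index only as a translation, and the sums of
`y ^ α · D'_{q-1-β}(y)` over a coset `F + c` do not depend on `c`: they are `-1` if `α = β` and `0`
otherwise (`sum_pow_mul_dualFactor`). So the pairing is `(-1) ^ n` if `j = k` and `0` otherwise
(`sum_dualProd_mul_digitProd`). Since `Dⱼ(m) = 0` for `j ≥ q ^ n` and `deg m < n`, this yields the
coefficient formula, hence uniqueness of expansions and `‖Bⱼ‖ ≤ ‖f‖`; the inequality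
`‖f‖ ≤ max ‖Bⱼ‖` is the ultrametric one.

*Existence.* Duality also shows that the values at the `q ^ n` polynomials of degree `< n` can be
interpolated by a combination of the `Dⱼ`, `j < q ^ n`, with coefficients of norm at most `‖f‖`. As
`Dⱼ` modulo `T` depends only on the argument modulo `T ^ n`, for `n` large this combination
approximates `f` to within `‖f‖ / q`. Iterating, the span of the `Dⱼ` is dense, and
the coefficient functionals, being contractions, extend the expansion to all of `C(O, K)`.

*The Carlitz polynomials.* The recursion `eₙ₊₁ = eₙ ^ q - eₙ(Tⁿ) ^ (q - 1) eₙ` gives linearity, and the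
identity `eₙ₊₁(Tx) = T eₙ₊₁(x) + [n+1] eₙ(x) ^ q` gives `eₙ(Tⁿ) = Fₙ`. The norm estimate compares the
products defining `eₙ(x)` and `eₙ(Tⁿ)` factor by factor.
-/

namespace CarlitzBases

/-! ### Power sums over a finite field -/

section PowerSums

variable {F L : Type*} [Field F] [Fintype F] [Field L] [Algebra F L]

theorem sum_pow_card_sub_one : ∑ a : F, a ^ (q F - 1) = -1 := by
  classical
  have hq := one_lt_q F
  have h : ∀ a : F, a ^ (q F - 1) = 1 - if a = 0 then 1 else 0 := by
    intro a
    split_ifs with ha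
    · rw [ha, zero_pow (by omega), sub_self]
    · rw [q, Nat.card_eq_fintype_card, FiniteField.pow_card_sub_one_eq_one a ha, sub_zero]
  simp only [h, sum_sub_distrib, sum_ite_eq', mem_univ, if_true, sum_const, card_univ,
    nsmul_eq_mul, FiniteField.cast_card_eq_zero, zero_mul, zero_sub]

theorem sum_algebraMap_add_pow {k : ℕ} (hk : k ≤ q F - 1) (c : L) :
    ∑ a : F, (algebraMap F L a + c) ^ k = if k = q F - 1 then -1 else 0 := by
  have h0 : ∀ i < q F - 1, ∑ a : F, a ^ i = 0 := fun i hi =>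
    FiniteField.sum_pow_lt_card_sub_one F i (by rwa [q, Nat.card_eq_fintype_card] at hi)
  have h1 : ∑ a : F, (algebraMap F L a + c) ^ k =
      ∑ i ∈ range (k + 1), algebraMap F L (∑ a : F, a ^ i) * (c ^ (k - i) * k.choose i) := by
    simp only [add_pow]
    rw [sum_comm]
    refine sum_congr rfl fun i _ => ?_
    rw [map_sum, sum_mul]
    exact sum_congr rfl fun a _ => by rw [map_pow]; ring
  rw [h1, sum_range_succ, sum_eq_zero fun i hi => ?_]
  · split_ifs with h
    · rw [h, sum_pow_card_sub_one]; simp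
    · rw [h0 k (by omega)]; simp
  · rw [h0 i (by rw [mem_range] at hi; omega), map_zero, zero_mul]

variable (F) in
/-- The factor `y ^ α`, or `y ^ α - 1` if `α = q - 1`, out of which `D'ⱼ` is built. -/
noncomputable def dualFactor (α : ℕ) (y : L) : L := if α = q F - 1 then y ^ α - 1 else y ^ α

/-- On each coset `F + c`, the functions `y ^ α` and `dualFactor F (q - 1 - β) y`
(`0 ≤ α, β < q`) are, up to sign, dual to each other for the summation pairing. -/
theorem sum_pow_mul_dualFactor {α β : ℕ} (hα : α < q F) (hβ : β < q F) (c : L) :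
    ∑ a : F, (algebraMap F L a + c) ^ α * dualFactor F (q F - 1 - β) (algebraMap F L a + c) =
      if α = β then -1 else 0 := by
  have hq := one_lt_q F
  -- The coset `F + c` is the set of roots of `y ^ q = y + d` with `d = c ^ q - c`.
  have hpow : ∀ (a : F) (t : ℕ), (algebraMap F L a + c) ^ (t + q F) =
      (algebraMap F L a + c) ^ (t + 1) + (c ^ q F - c) * (algebraMap F L a + c) ^ t := by
    intro a t
    have : (algebraMap F L a + c) ^ q F = algebraMap F L a + c ^ q F := by
      have h2 := map_add (FiniteField.frobeniusAlgHom F L) (algebraMap F L a) c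
      simpa only [AlgHom.commutes, FiniteField.coe_frobeniusAlgHom, q,
        Nat.card_eq_fintype_card] using h2
    rw [pow_add, this]
    ring
  have hsum : ∀ t, t + 1 ≤ q F - 1 → ∑ a : F, (algebraMap F L a + c) ^ (t + q F) =
      if t + 1 = q F - 1 then -1 else 0 := by
    intro t ht
    simp only [hpow, sum_add_distrib]
    rw [← mul_sum, sum_algebraMap_add_pow ht, sum_algebraMap_add_pow (k := t) (by omega),
      if_neg (show ¬ t = q F - 1 by omega), mul_zero, add_zero]
  rcases Nat.eq_zero_or_pos β with rfl | hβ0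
  · simp only [dualFactor, Nat.sub_zero, if_true, mul_sub, mul_one, sum_sub_distrib, ← pow_add]
    rw [sum_algebraMap_add_pow (k := α) (by omega)]
    rcases Nat.eq_zero_or_pos α with rfl | hα0
    · rw [sum_algebraMap_add_pow (k := 0 + (q F - 1)) (by omega)]
      simp only [zero_add, if_true]
      rw [if_neg (by omega), sub_zero]
    · obtain ⟨t, rfl⟩ := Nat.exists_eq_add_of_lt hα0
      rw [show 0 + t + 1 + (q F - 1) = t + q F by omega, hsum t (by omega)]
      simp
  · simp only [dualFactor, if_neg (show ¬ q F - 1 - β = q F - 1 by omega), ← pow_add]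
    rcases le_or_gt α β with h | h
    · rw [sum_algebraMap_add_pow (by omega)]
      exact if_congr (by omega) rfl rfl
    · obtain ⟨t, rfl⟩ := Nat.exists_eq_add_of_lt h
      rw [show β + t + 1 + (q F - 1 - β) = t + q F by omega, hsum t (by omega)]
      rw [if_neg (by omega), if_neg (by omega)]

end PowerSums

/-! ### Polynomials inside the ring of power series -/

section Polynomials

variable {F : Type*} [Field F]

theorem polyO_coeff (m : Polynomial F) (n : ℕ) : ((polyO m : O F) : F⸨X⸩).coeff n = m.coeff n := by
  simp [polyO, LaurentSeries.coeff_coe_powerSeries]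

theorem coeff_of_neg (x : O F) {n : ℤ} (hn : n < 0) : (x : F⸨X⸩).coeff n = 0 := by
  obtain ⟨_, p, -, rfl⟩ := x
  exact (PowerSeries.coeff_coe p n).trans (if_pos hn)

theorem T_pow_coeff (n : ℕ) (k : ℤ) : (T F ^ n).coeff k = if k = n then 1 else 0 := by
  rw [T, PowerSeries.coe_X, HahnSeries.single_pow, HahnSeries.coeff_single]
  simp

theorem ext_coeff {x y : O F} (h : ∀ n : ℕ, (x : F⸨X⸩).coeff n = (y : F⸨X⸩).coeff n) : x = y := by
  ext n
  rcases lt_or_ge n 0 with hn | hn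
  · rw [coeff_of_neg x hn, coeff_of_neg y hn]
  · obtain ⟨n, rfl⟩ := Int.eq_ofNat_of_zero_le hn
    exact h n

/-- A polynomial of degree `< n + 1` is uniquely `m + a Tⁿ` with `deg m < n`. -/
theorem bijOn_polysLT_succ (n : ℕ) :
    Set.BijOn (fun x : F × Polynomial F => x.2 + Polynomial.C x.1 * Polynomial.X ^ n)
      {x | x.2.degree < n} {m : Polynomial F | m.degree < ((n + 1 : ℕ) : WithBot ℕ)} := by
  have hco : ∀ m : Polynomial F, m.degree < n → m.coeff n = 0 := fun m hm =>
    Polynomial.coeff_eq_zero_of_degree_lt hm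
  refine Set.InvOn.bijOn
    (f' := fun m => (m.coeff n, m - Polynomial.C (m.coeff n) * Polynomial.X ^ n)) ⟨?_, ?_⟩ ?_ ?_
  · rintro ⟨a, m⟩ hx
    simp [hco m hx]
  · intro m _
    simp
  · rintro ⟨a, m⟩ hx
    change (m + Polynomial.C a * Polynomial.X ^ n).degree < ((n + 1 : ℕ) : WithBot ℕ)
    refine lt_of_le_of_lt (Polynomial.degree_add_le _ _) (max_lt ?_ ?_)
    · exact lt_trans hx (by exact_mod_cast Nat.lt_succ_self n)
    · exact (Polynomial.degree_C_mul_X_pow_le n a).trans_lt (by exact_mod_cast Nat.lt_succ_self n)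
  · intro m hm
    change m.degree < ((n + 1 : ℕ) : WithBot ℕ) at hm
    change (m - Polynomial.C (m.coeff n) * Polynomial.X ^ n).degree < (n : WithBot ℕ)
    rw [Polynomial.degree_lt_iff_coeff_zero] at hm ⊢
    intro k hk
    rw [Polynomial.coeff_sub, Polynomial.coeff_C_mul, Polynomial.coeff_X_pow]
    rcases Nat.eq_or_lt_of_le hk with rfl | hk
    · simp
    · rw [hm k hk, if_neg (by omega)]; simp

theorem polyO_add (m m' : Polynomial F) : polyO (m + m') = polyO m + polyO m' := by
  refine ext_coeff fun n => ?_
  simp [polyO_coeff]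

theorem algebraMap_mul_coeff (a : F) (x : F⸨X⸩) (k : ℤ) :
    (algebraMap F F⸨X⸩ a * x).coeff k = a * x.coeff k := by
  have h : algebraMap F F⸨X⸩ a = HahnSeries.C a := by
    rw [HahnSeries.algebraMap_apply']
    exact HahnSeries.ofPowerSeries_C a
  rw [h, HahnSeries.C_mul_eq_smul, HahnSeries.coeff_smul, smul_eq_mul]

theorem polyO_C_mul_X_pow (a : F) (n : ℕ) :
    ((polyO (Polynomial.C a * Polynomial.X ^ n) : O F) : F⸨X⸩) =
      algebraMap F F⸨X⸩ a * T F ^ n := by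
  ext k
  rw [algebraMap_mul_coeff, T_pow_coeff]
  rcases lt_or_ge k 0 with hk | hk
  · rw [coeff_of_neg _ hk, if_neg (by omega), mul_zero]
  · obtain ⟨k, rfl⟩ := Int.eq_ofNat_of_zero_le hk
    rw [polyO_coeff, Polynomial.coeff_C_mul, Polynomial.coeff_X_pow]
    simp

theorem polyO_X_pow (n : ℕ) : ((polyO (Polynomial.X ^ n) : O F) : F⸨X⸩) = T F ^ n := by
  simpa using polyO_C_mul_X_pow (1 : F) n

variable [Finite F]

theorem polysLT_zero : polysLT F 0 = {0} := by
  ext m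
  simp [← Polynomial.degree_eq_bot, Nat.WithBot.lt_zero_iff]

theorem prod_polysLT_succ [Fintype F] {A : Type*} [CommMonoid A] (n : ℕ) (g : Polynomial F → A) :
    ∏ m ∈ polysLT F (n + 1), g m =
      ∏ a : F, ∏ m ∈ polysLT F n, g (m + Polynomial.C a * Polynomial.X ^ n) := by
  rw [← Finset.prod_product']
  have h := bijOn_polysLT_succ (F := F) n
  refine (Finset.prod_nbij (fun x : F × Polynomial F => x.2 + Polynomial.C x.1 * Polynomial.X ^ n)
    (fun x hx => ?_) (fun x hx y hy => ?_) (fun m hm => ?_) fun _ _ => rfl).symm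
  · rw [mem_product, mem_polysLT] at hx
    exact (mem_polysLT F).mpr (h.mapsTo hx.2)
  · rw [mem_coe, mem_product, mem_polysLT] at hx hy
    exact h.injOn hx.2 hy.2
  · rw [mem_coe, mem_polysLT] at hm
    obtain ⟨x, hx, rfl⟩ := h.surjOn hm
    exact ⟨x, mem_coe.mpr (mem_product.mpr ⟨mem_univ _, (mem_polysLT F).mpr hx⟩), rfl⟩

theorem sum_polysLT_succ [Fintype F] {A : Type*} [AddCommMonoid A] (n : ℕ)
    (g : Polynomial F → A) :
    ∑ m ∈ polysLT F (n + 1), g m =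
      ∑ a : F, ∑ m ∈ polysLT F n, g (m + Polynomial.C a * Polynomial.X ^ n) :=
  prod_polysLT_succ (A := Multiplicative A) n g

theorem card_polysLT (n : ℕ) : (polysLT F n).card = q F ^ n := by
  have := Fintype.ofFinite F
  induction n with
  | zero => simp [polysLT_zero]
  | succ n ih =>
    have := sum_polysLT_succ n fun _ : Polynomial F => 1
    rw [← card_eq_sum_ones, ← card_eq_sum_ones] at this
    rw [this, ih, sum_const, card_univ, q, Nat.card_eq_fintype_card, smul_eq_mul, pow_succ']

end Polynomials

/-! ### Digits in base `q` -/

section Digits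

variable (F : Type*)

theorem digit_eq_zero {j i : ℕ} (h : j < q F ^ i) : digit F j i = 0 := by
  rw [digit, Nat.div_eq_of_lt h, Nat.zero_mod]

theorem digit_succ (j i : ℕ) : digit F j (i + 1) = digit F (j / q F) i := by
  rw [digit, digit, Nat.div_div_eq_div_mul, pow_succ']

theorem eq_of_digit_eq {n : ℕ} : ∀ {j k : ℕ}, j < q F ^ n → k < q F ^ n →
    (∀ i < n, digit F j i = digit F k i) → j = k := by
  induction n with
  | zero => intro j k hj hk _; rw [pow_zero] at hj hk; omega
  | succ n ih =>
    intro j k hj hk h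
    have h0 := h 0 (Nat.succ_pos n)
    simp only [digit, pow_zero, Nat.div_one] at h0
    have h1 : j / q F = k / q F :=
      ih (Nat.div_lt_of_lt_mul (by rwa [← pow_succ'])) (Nat.div_lt_of_lt_mul (by rwa [← pow_succ']))
        fun i hi => by rw [← digit_succ, ← digit_succ]; exact h _ (by omega)
    rw [← Nat.div_add_mod j (q F), ← Nat.div_add_mod k (q F), h0, h1]

variable [Field F] [Finite F]

theorem digit_lt (j i : ℕ) : digit F j i < q F :=
  Nat.mod_lt _ (zero_lt_one.trans (one_lt_q F))

theorem prod_digit_eq {A : Type*} [CommMonoid A] (h : ℕ → ℕ → A) (h0 : ∀ i, h 0 i = 1) {j n : ℕ}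
    (hj : j < q F ^ n) :
    ∏ i ∈ range (numDigits F j), h (digit F j i) i = ∏ i ∈ range n, h (digit F j i) i := by
  refine prod_subset ?_ fun i _ hi => ?_
  · rw [range_subset_range]
    exact (Nat.digits_length_le_iff (one_lt_q F) j).mpr hj
  · rw [mem_range, not_lt, numDigits, Nat.digits_length_le_iff (one_lt_q F)] at hi
    rw [digit_eq_zero F hi, h0]

theorem digit_compl {j n i : ℕ} (hj : j < q F ^ n) (hi : i < n) :
    digit F (q F ^ n - 1 - j) i = q F - 1 - digit F j i := by
  have hq := one_lt_q F
  obtain ⟨k, rfl⟩ := Nat.exists_eq_add_of_lt hi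
  have hpow : q F ^ (i + k + 1) = q F ^ i * (q F * q F ^ k) := by ring
  rw [digit, digit, show q F ^ (i + k + 1) - 1 - j = q F ^ (i + k + 1) - (j + 1) by omega, hpow,
    Nat.mul_sub_div _ _ _ (by rwa [← hpow])]
  have hy : j / q F ^ i < q F * q F ^ k := Nat.div_lt_of_lt_mul (by rwa [← hpow])
  generalize j / q F ^ i = y at hy
  have hr := Nat.mod_lt y (zero_lt_one.trans hq)
  have hu : y / q F < q F ^ k := Nat.div_lt_of_lt_mul hy
  obtain ⟨d, hd⟩ := Nat.exists_eq_add_of_lt hu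
  have hsplit : q F * q F ^ k - (y + 1) = (q F - 1 - y % q F) + q F * d := by
    have h1 := Nat.div_add_mod y (q F)
    have h2 : q F * q F ^ k = q F * (y / q F) + q F * d + q F := by rw [hd]; ring
    omega
  rw [hsplit, Nat.add_mul_mod_self_left, Nat.mod_eq_of_lt (by omega)]

end Digits

/-! ### Digit families and duality -/

section Family

variable {F : Type*} [Field F] [Finite F]

/-- A sequence of additive functions `O → K` behaving like the `i`-th digit of `∑ aᵢ Tⁱ`: it
vanishes on polynomials of degree `< i`, takes the value `a` at `a Tⁱ`, and contracts `Tⁱ O` as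
division by `Tⁱ` does. -/
structure IsDigitFamily (g : ℕ → C(O F, F⸨X⸩)) : Prop where
  apply_add : ∀ i x y, g i (x + y) = g i x + g i y
  apply_polyO : ∀ (i : ℕ) (m : Polynomial F), m.degree < i → g i (polyO m) = 0
  apply_C_mul_X_pow : ∀ (i : ℕ) (a : F),
    g i (polyO (Polynomial.C a * Polynomial.X ^ i)) = algebraMap F F⸨X⸩ a
  norm_apply_le : ∀ (i : ℕ) (x : O F), ‖(x : F⸨X⸩)‖ ≤ (q F : ℝ) ^ (-(i : ℤ)) →
    ‖g i x‖ ≤ (q F : ℝ) ^ i * ‖(x : F⸨X⸩)‖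

/-- The product `∏ᵢ gᵢ ^ αᵢ` over the digits `αᵢ` of `j`. -/
noncomputable def digitProd (g : ℕ → C(O F, F⸨X⸩)) (j : ℕ) : C(O F, F⸨X⸩) :=
  ∏ i ∈ range (numDigits F j), g i ^ digit F j i

/-- The product over the digits `αᵢ` of `j` of the functions `gᵢ ^ αᵢ`, lowered by `1` when
`αᵢ = q - 1`. -/
noncomputable def dualProd (g : ℕ → C(O F, F⸨X⸩)) (j : ℕ) : C(O F, F⸨X⸩) :=
  ∏ i ∈ range (numDigits F j),
    if digit F j i = q F - 1 then g i ^ digit F j i - 1 else g i ^ digit F j i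

variable {g : ℕ → C(O F, F⸨X⸩)}

theorem digitProd_apply {j n : ℕ} (hj : j < q F ^ n) (x : O F) :
    digitProd g j x = ∏ i ∈ range n, g i x ^ digit F j i := by
  rw [digitProd, ContinuousMap.prod_apply]
  exact prod_digit_eq F (fun α i => (g i ^ α) x) (fun i => by simp) hj

theorem dualProd_apply {j n : ℕ} (hj : j < q F ^ n) (x : O F) :
    dualProd g j x = ∏ i ∈ range n, dualFactor F (digit F j i) (g i x) := by
  have hq := one_lt_q F
  rw [dualProd, ContinuousMap.prod_apply,
    ← prod_digit_eq F (fun α i => dualFactor F α (g i x))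
      (fun i => by simp [dualFactor, (show ¬ 0 = q F - 1 by omega)]) hj]
  refine prod_congr rfl fun i _ => ?_
  rw [dualFactor]
  split_ifs <;> simp

namespace IsDigitFamily

theorem sum_prod_apply_add (hg : IsDigitFamily g) [Fintype F] (h : ℕ → F⸨X⸩ → F⸨X⸩) (s : ℕ → F⸨X⸩)
    (n : ℕ) (hs : ∀ i < n, ∀ c, ∑ a : F, h i (algebraMap F F⸨X⸩ a + c) = s i) (c : ℕ → F⸨X⸩) :
    ∑ m ∈ polysLT F n, ∏ i ∈ range n, h i (g i (polyO m) + c i) = ∏ i ∈ range n, s i := by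
  induction n generalizing c with
  | zero => simp [polysLT_zero]
  | succ n ih =>
    rw [sum_polysLT_succ, prod_range_succ, ← hs n (Nat.lt_succ_self n) (c n), mul_sum]
    refine sum_congr rfl fun a _ => ?_
    -- The top coefficient `a` shifts the arguments of the lower factors, and `hs` covers all shifts.
    rw [← ih (fun i hi => hs i (by omega))
      (fun i => g i (polyO (Polynomial.C a * Polynomial.X ^ n)) + c i), sum_mul]
    refine sum_congr rfl fun m hm => ?_
    rw [prod_range_succ, polyO_add, hg.apply_add n, hg.apply_polyO n m ((mem_polysLT F).mp hm),
      hg.apply_C_mul_X_pow, zero_add]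
    congr 1
    exact prod_congr rfl fun i _ => by rw [hg.apply_add, add_assoc]

/-- The functions `dualProd g (q ^ n - 1 - j)` are dual to the `digitProd g j`, `j < q ^ n`, for
summation over the polynomials of degree `< n`. -/
theorem sum_dualProd_mul_digitProd (hg : IsDigitFamily g) {j k n : ℕ} (hj : j < q F ^ n)
    (hk : k < q F ^ n) :
    (-1) ^ n * ∑ m ∈ polysLT F n, dualProd g (q F ^ n - 1 - j) (polyO m) *
      digitProd g k (polyO m) = if j = k then 1 else 0 := by
  have := Fintype.ofFinite F
  have hlt : q F ^ n - 1 - j < q F ^ n := by omega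
  have h := hg.sum_prod_apply_add
    (fun i y => y ^ digit F k i * dualFactor F (q F - 1 - digit F j i) y)
    (fun i => if digit F k i = digit F j i then -1 else 0) n
    (fun i _ c => sum_pow_mul_dualFactor (digit_lt F k i) (digit_lt F j i) c) 0
  have h2 : ∑ m ∈ polysLT F n, dualProd g (q F ^ n - 1 - j) (polyO m) * digitProd g k (polyO m) =
      ∏ i ∈ range n, if digit F k i = digit F j i then (-1 : F⸨X⸩) else 0 := by
    rw [← h]
    refine sum_congr rfl fun m _ => ?_
    rw [dualProd_apply hlt, digitProd_apply hk, ← prod_mul_distrib]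
    refine prod_congr rfl fun i hi => ?_
    rw [digit_compl F hj (mem_range.mp hi), Pi.zero_apply, add_zero, mul_comm]
  rw [h2]
  split_ifs with hjk
  · rw [hjk]
    simp [← mul_pow]
  · obtain ⟨i, hi, hne⟩ : ∃ i < n, digit F k i ≠ digit F j i := by
      by_contra! hcon
      exact hjk (eq_of_digit_eq F hj hk fun i hi => (hcon i hi).symm)
    rw [prod_eq_zero (mem_range.mpr hi) (if_neg hne), mul_zero]

theorem digitProd_apply_polyO_eq_zero (hg : IsDigitFamily g) {j n : ℕ} (hj : q F ^ n ≤ j)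
    {m : Polynomial F} (hm : m.degree < n) : digitProd g j (polyO m) = 0 := by
  -- The leading digit of `j`, in position `i ≥ n`, is nonzero, and `gᵢ` vanishes at `m`.
  obtain ⟨i, hi, hne⟩ : ∃ i, n ≤ i ∧ digit F j i ≠ 0 := by
    have hj0 : j ≠ 0 := by have := pow_pos (zero_lt_one.trans (one_lt_q F)) n; omega
    refine ⟨Nat.log (q F) j, (Nat.le_log_iff_pow_le (one_lt_q F) hj0).mpr hj, ?_⟩
    have h1 : 1 ≤ j / q F ^ Nat.log (q F) j :=
      (Nat.one_le_div_iff (pow_pos (zero_lt_one.trans (one_lt_q F)) _)).mpr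
        (Nat.pow_log_le_self _ hj0)
    have h2 : j / q F ^ Nat.log (q F) j < q F :=
      Nat.div_lt_of_lt_mul (by
        rw [← pow_succ]; exact Nat.lt_pow_succ_log_self (one_lt_q F) _)
    rw [digit, Nat.mod_eq_of_lt h2]
    omega
  have hlt : j < q F ^ (max j i + 1) :=
    (Nat.lt_pow_self (one_lt_q F)).trans (Nat.pow_lt_pow_right (one_lt_q F) (by omega))
  rw [digitProd_apply hlt]
  refine prod_eq_zero (i := i) (mem_range.mpr (by omega)) ?_
  rw [hg.apply_polyO i m (hm.trans_le (by exact_mod_cast hi)), zero_pow hne]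

end IsDigitFamily

/-- The linear functional `f ↦ (-1) ^ n * ∑ D'(m) f(m)`, over `deg m < n`, which computes the `j`-th
coefficient of `f` when `j < q ^ n`. -/
noncomputable def coeffFunctional (g : ℕ → C(O F, F⸨X⸩)) (n j : ℕ) :
    C(O F, F⸨X⸩) →ₗ[F⸨X⸩] F⸨X⸩ where
  toFun f := (-1) ^ n * ∑ m ∈ polysLT F n, dualProd g (q F ^ n - 1 - j) (polyO m) * f (polyO m)
  map_add' f f' := by
    simp only [ContinuousMap.add_apply, mul_add, sum_add_distrib]
  map_smul' c f := by
    simp only [ContinuousMap.smul_apply, smul_eq_mul, RingHom.id_apply, mul_sum]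
    exact sum_congr rfl fun m _ => by ring

namespace IsDigitFamily

theorem coeffFunctional_digitProd (hg : IsDigitFamily g) {j n : ℕ} (hj : j < q F ^ n) (k : ℕ) :
    coeffFunctional g n j (digitProd g k) = if j = k then 1 else 0 := by
  rcases lt_or_ge k (q F ^ n) with hk | hk
  · exact hg.sum_dualProd_mul_digitProd hj hk
  · rw [if_neg (by omega), coeffFunctional, LinearMap.coe_mk, AddHom.coe_mk,
      sum_eq_zero fun m hm => ?_, mul_zero]
    rw [hg.digitProd_apply_polyO_eq_zero hk ((mem_polysLT F).mp hm), mul_zero]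

/-- Only the first `q ^ n` terms of the expansion of `f` contribute to `coeffFunctional g n j f`. -/
theorem eq_coeffFunctional_of_hasExpansion (hg : IsDigitFamily g) {f : C(O F, F⸨X⸩)}
    {B : ℕ → F⸨X⸩} (hB : HasExpansion (digitProd g) B f) {j n : ℕ} (hj : j < q F ^ n) :
    B j = coeffFunctional g n j f := by
  have hcont : Continuous (coeffFunctional g n j) :=
    continuous_const.mul <| continuous_finsetSum _ fun m _ =>
      continuous_const.mul (continuous_eval_const _)
  have h := (hcont.tendsto f).comp hB
  refine tendsto_nhds_unique (tendsto_const_nhds.congr' ?_) h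
  filter_upwards [eventually_gt_atTop j] with N hN
  simp only [Function.comp_apply, map_sum, map_smul, hg.coeffFunctional_digitProd hj, smul_eq_mul,
    mul_ite, mul_one, mul_zero, sum_ite_eq, mem_range, if_pos hN]

end IsDigitFamily

end Family

/-! ### Products in ultrametric fields -/

section Ultrametric

variable {L ι : Type*} [NormedField L]

theorem norm_sub_le_max_norm [IsUltrametricDist L] (x y : L) : ‖x - y‖ ≤ max ‖x‖ ‖y‖ := by
  simpa [sub_eq_add_neg] using IsUltrametricDist.norm_add_le_max x (-y)

theorem norm_prod_sub_prod_le [IsUltrametricDist L] {r : ℝ} (hr : 0 ≤ r) (s : Finset ι)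
    (y z : ι → L) (hy : ∀ i ∈ s, ‖y i‖ ≤ 1) (hz : ∀ i ∈ s, ‖z i‖ ≤ 1)
    (h : ∀ i ∈ s, ‖y i - z i‖ ≤ r) : ‖∏ i ∈ s, y i - ∏ i ∈ s, z i‖ ≤ r := by
  classical
  induction s using Finset.induction_on with
  | empty => simpa using hr
  | insert a s ha ih =>
    rw [prod_insert ha, prod_insert ha, show y a * ∏ i ∈ s, y i - z a * ∏ i ∈ s, z i =
      y a * (∏ i ∈ s, y i - ∏ i ∈ s, z i) + (y a - z a) * ∏ i ∈ s, z i by ring]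
    have h1 : ‖∏ i ∈ s, z i‖ ≤ 1 := by
      rw [norm_prod]
      exact prod_le_one (fun _ _ => norm_nonneg _) fun i hi => hz i (mem_insert_of_mem hi)
    have h2 := ih (fun i hi => hy i (mem_insert_of_mem hi))
      (fun i hi => hz i (mem_insert_of_mem hi)) fun i hi => h i (mem_insert_of_mem hi)
    refine (IsUltrametricDist.norm_add_le_max _ _).trans (max_le ?_ ?_)
    · rw [norm_mul]
      exact (mul_le_of_le_one_left (norm_nonneg _) (hy a (mem_insert_self a s))).trans h2
    · rw [norm_mul]
      exact (mul_le_of_le_one_right (norm_nonneg _) h1).trans (h a (mem_insert_self a s))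

theorem norm_pow_sub_pow_le [IsUltrametricDist L] {r : ℝ} (hr : 0 ≤ r) {y z : L}
    (hy : ‖y‖ ≤ 1) (hz : ‖z‖ ≤ 1) (h : ‖y - z‖ ≤ r) (k : ℕ) : ‖y ^ k - z ^ k‖ ≤ r := by
  simpa using norm_prod_sub_prod_le hr (range k) (fun _ => y) (fun _ => z) (fun _ _ => hy)
    (fun _ _ => hz) fun _ _ => h

end Ultrametric

/-! ### Expansions along a digit family -/

section Family

variable {F : Type*} [Field F] [Finite F]

theorem exists_norm_sub_polyO_le (x : O F) (n : ℕ) :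
    ∃ m ∈ polysLT F n, ‖((x - polyO m : O F) : F⸨X⸩)‖ ≤ (q F : ℝ) ^ (-(n : ℤ)) := by
  refine ⟨(PowerSeries.mk fun k => (x : F⸨X⸩).coeff k).trunc n,
    (mem_polysLT F).mpr (PowerSeries.degree_trunc_lt _ n), ?_⟩
  rw [norm_le_zpow_iff]
  intro k hk
  rcases lt_or_ge k 0 with hk0 | hk0
  · exact coeff_of_neg _ hk0
  · obtain ⟨k, rfl⟩ := Int.eq_ofNat_of_zero_le hk0
    rw [AddSubgroupClass.coe_sub, HahnSeries.coeff_sub, polyO_coeff, PowerSeries.coeff_trunc,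
      if_pos (by omega), PowerSeries.coeff_mk, sub_self]

variable {g : ℕ → C(O F, F⸨X⸩)}

namespace IsDigitFamily

theorem norm_sub_le_zpow (hg : IsDigitFamily g) {i n : ℕ} (hi : i ≤ n) {x y : O F}
    (h : ‖((x - y : O F) : F⸨X⸩)‖ ≤ (q F : ℝ) ^ (-(n : ℤ))) :
    ‖g i x - g i y‖ ≤ (q F : ℝ) ^ ((i : ℤ) - n) := by
  have hq : (1 : ℝ) < q F := by exact_mod_cast one_lt_q F
  have h1 : g i x - g i y = g i (x - y) := by
    rw [sub_eq_iff_eq_add, ← hg.apply_add, sub_add_cancel]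
  rw [h1]
  refine (hg.norm_apply_le i _ (h.trans (zpow_le_zpow_right₀ hq.le (by omega)))).trans ?_
  rw [sub_eq_add_neg (i : ℤ), zpow_add₀ (by positivity), zpow_natCast]
  gcongr

theorem norm_apply_le_one (hg : IsDigitFamily g) (i : ℕ) (x : O F) : ‖g i x‖ ≤ 1 := by
  obtain ⟨m, hm, h⟩ := exists_norm_sub_polyO_le x i
  have := hg.norm_sub_le_zpow le_rfl h
  rwa [hg.apply_polyO i m ((mem_polysLT F).mp hm), sub_zero, sub_self, zpow_zero] at this

theorem norm_digitProd_apply_le_one (hg : IsDigitFamily g) (j : ℕ) (x : O F) :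
    ‖digitProd g j x‖ ≤ 1 := by
  rw [digitProd, ContinuousMap.prod_apply, norm_prod]
  refine prod_le_one (fun _ _ => norm_nonneg _) fun i _ => ?_
  rw [ContinuousMap.pow_apply, norm_pow]
  exact pow_le_one₀ (norm_nonneg _) (hg.norm_apply_le_one i x)

theorem norm_dualProd_apply_le_one (hg : IsDigitFamily g) (j : ℕ) (x : O F) :
    ‖dualProd g j x‖ ≤ 1 := by
  rw [dualProd, ContinuousMap.prod_apply, norm_prod]
  refine prod_le_one (fun _ _ => norm_nonneg _) fun i _ => ?_
  have h : ‖g i x ^ digit F j i‖ ≤ 1 := by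
    rw [norm_pow]
    exact pow_le_one₀ (norm_nonneg _) (hg.norm_apply_le_one i x)
  split_ifs
  · refine (norm_sub_le_max_norm _ _).trans (max_le h ?_)
    rw [ContinuousMap.one_apply, norm_one]
  · exact h

theorem norm_coeffFunctional_le (hg : IsDigitFamily g) (n j : ℕ) (f : C(O F, F⸨X⸩)) :
    ‖coeffFunctional g n j f‖ ≤ ‖f‖ := by
  rw [coeffFunctional, LinearMap.coe_mk, AddHom.coe_mk, norm_mul, norm_pow, norm_neg, norm_one,
    one_pow, one_mul]
  refine IsUltrametricDist.norm_sum_le_of_forall_le_of_nonneg (norm_nonneg f) fun m _ => ?_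
  rw [norm_mul]
  exact (mul_le_of_le_one_left (norm_nonneg _) (hg.norm_dualProd_apply_le_one _ _)).trans
    (f.norm_coe_le_norm _)

theorem norm_sum_smul_digitProd_apply_le (hg : IsDigitFamily g) {r : ℝ} (hr : 0 ≤ r) {N : ℕ}
    {b : ℕ → F⸨X⸩} (hb : ∀ j < N, ‖b j‖ ≤ r) :
    ‖∑ j ∈ range N, b j • digitProd g j‖ ≤ r := by
  refine (ContinuousMap.norm_le _ hr).mpr fun x => ?_
  rw [ContinuousMap.sum_apply]
  refine IsUltrametricDist.norm_sum_le_of_forall_le_of_nonneg hr fun j hj => ?_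
  rw [ContinuousMap.smul_apply, smul_eq_mul, norm_mul]
  exact (mul_le_of_le_one_right (norm_nonneg _) (hg.norm_digitProd_apply_le_one _ _)).trans
    (hb j (mem_range.mp hj))

/-- The duality relations say that two square matrices of size `q ^ n` are inverse to each other;
reading this in the other order gives interpolation at the polynomials of degree `< n`. -/
theorem sum_coeffFunctional_smul_apply (hg : IsDigitFamily g) (n : ℕ) (f : C(O F, F⸨X⸩))
    {m : Polynomial F} (hm : m ∈ polysLT F n) :
    (∑ j ∈ range (q F ^ n), coeffFunctional g n j f • digitProd g j) (polyO m) = f (polyO m) := by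
  classical
  let A : Matrix (Fin (q F ^ n)) (polysLT F n) F⸨X⸩ :=
    Matrix.of fun j m => (-1) ^ n * dualProd g (q F ^ n - 1 - j) (polyO m.1)
  let P : Matrix (polysLT F n) (Fin (q F ^ n)) F⸨X⸩ :=
    Matrix.of fun m k => digitProd g k (polyO m.1)
  have hAP : A * P = 1 := by
    refine Matrix.ext fun j k => ?_
    rw [Matrix.mul_apply, Matrix.one_apply]
    simp only [A, P, Matrix.of_apply, Fin.ext_iff]
    rw [← hg.sum_dualProd_mul_digitProd j.2 k.2, mul_sum, ← sum_coe_sort (polysLT F n)]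
    exact sum_congr rfl fun m _ => mul_assoc ((-1) ^ n) _ _
  have hPA : P * A = 1 := (Matrix.mul_eq_one_comm_of_card_eq _ _ _ (by simp [card_polysLT])).mp hAP
  have hco : ∀ j : Fin (q F ^ n), coeffFunctional g n j f =
      A.mulVec (fun m => f (polyO m.1)) j := by
    intro j
    simp only [coeffFunctional, LinearMap.coe_mk, AddHom.coe_mk, Matrix.mulVec, dotProduct, A,
      Matrix.of_apply]
    rw [mul_sum, ← sum_coe_sort (polysLT F n)]
    exact sum_congr rfl fun m _ => (mul_assoc ((-1) ^ n) _ _).symm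
  have h := congrFun (congrArg (fun M => M.mulVec fun m => f (polyO m.1)) hPA) ⟨m, hm⟩
  simp only [Matrix.one_mulVec] at h
  rw [← h, ← Matrix.mulVec_mulVec, ContinuousMap.sum_apply, ← Fin.sum_univ_eq_sum_range
    (fun j => (coeffFunctional g n j f • digitProd g j) (polyO m))]
  refine sum_congr rfl fun j _ => ?_
  rw [ContinuousMap.smul_apply, hco, smul_eq_mul, mul_comm]
  rfl

/-- Modulo `T`, `digitProd g j` with `j < q ^ n` depends on its argument modulo `T ^ n` only. -/
theorem norm_digitProd_sub_le (hg : IsDigitFamily g) {j n : ℕ} (hj : j < q F ^ n) {x y : O F}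
    (h : ‖((x - y : O F) : F⸨X⸩)‖ ≤ (q F : ℝ) ^ (-(n : ℤ))) :
    ‖digitProd g j x - digitProd g j y‖ ≤ (q F : ℝ)⁻¹ := by
  have hq : (1 : ℝ) < q F := by exact_mod_cast one_lt_q F
  rw [digitProd_apply hj, digitProd_apply hj]
  refine norm_prod_sub_prod_le (by positivity) _ _ _ (fun i _ => ?_) (fun i _ => ?_) fun i hi => ?_
  · rw [norm_pow]
    exact pow_le_one₀ (norm_nonneg _) (hg.norm_apply_le_one i x)
  · rw [norm_pow]
    exact pow_le_one₀ (norm_nonneg _) (hg.norm_apply_le_one i y)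
  · refine norm_pow_sub_pow_le (by positivity) (hg.norm_apply_le_one i x)
      (hg.norm_apply_le_one i y) ?_ _
    rw [mem_range] at hi
    refine (hg.norm_sub_le_zpow hi.le h).trans ?_
    rw [← zpow_neg_one]
    exact zpow_le_zpow_right₀ hq.le (by omega)

/-- One approximation step: interpolate `f` at the polynomials of degree `< n`, where `n` is so large
that `f` varies by at most `‖f‖ / q` on each coset of `Tⁿ O`. -/
theorem exists_mem_span_norm_sub_le (hg : IsDigitFamily g) (f : C(O F, F⸨X⸩)) :
    ∃ h ∈ Submodule.span F⸨X⸩ (Set.range (digitProd g)), ‖f - h‖ ≤ (q F : ℝ)⁻¹ * ‖f‖ := by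
  have hq : (1 : ℝ) < q F := by exact_mod_cast one_lt_q F
  rcases eq_or_ne f 0 with rfl | hf
  · exact ⟨0, Submodule.zero_mem _, by simp⟩
  have hε : 0 < (q F : ℝ)⁻¹ * ‖f‖ := mul_pos (by positivity) (norm_pos_iff.mpr hf)
  obtain ⟨δ, hδ, hfδ⟩ := Metric.uniformContinuous_iff.mp
    (CompactSpace.uniformContinuous_of_continuous f.continuous) _ hε
  obtain ⟨n, hn⟩ := exists_pow_lt_of_lt_one hδ (inv_lt_one_of_one_lt₀ hq)
  refine ⟨∑ j ∈ range (q F ^ n), coeffFunctional g n j f • digitProd g j,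
    Submodule.sum_mem _ fun j _ => Submodule.smul_mem _ _ (Submodule.subset_span ⟨j, rfl⟩), ?_⟩
  refine (ContinuousMap.norm_le _ hε.le).mpr fun x => ?_
  obtain ⟨m, hm, hxm⟩ := exists_norm_sub_polyO_le x n
  have h1 : ‖f x - f (polyO m)‖ ≤ (q F : ℝ)⁻¹ * ‖f‖ := by
    rw [← dist_eq_norm]
    refine (hfδ ?_).le
    rw [Subtype.dist_eq, dist_eq_norm, ← AddSubgroupClass.coe_sub]
    refine hxm.trans_lt ?_
    rwa [zpow_neg, zpow_natCast, ← inv_pow]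
  have h2 : ‖(∑ j ∈ range (q F ^ n), coeffFunctional g n j f • digitProd g j) x -
      (∑ j ∈ range (q F ^ n), coeffFunctional g n j f • digitProd g j) (polyO m)‖ ≤
      (q F : ℝ)⁻¹ * ‖f‖ := by
    rw [ContinuousMap.sum_apply, ContinuousMap.sum_apply, ← sum_sub_distrib]
    refine IsUltrametricDist.norm_sum_le_of_forall_le_of_nonneg hε.le fun j hj => ?_
    rw [ContinuousMap.smul_apply, ContinuousMap.smul_apply, ← smul_sub, smul_eq_mul, norm_mul,
      mul_comm]
    exact mul_le_mul (hg.norm_digitProd_sub_le (mem_range.mp hj) hxm)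
      (hg.norm_coeffFunctional_le n j f) (norm_nonneg _) (by positivity)
  rw [hg.sum_coeffFunctional_smul_apply n f hm] at h2
  rw [ContinuousMap.sub_apply, ← sub_sub_sub_cancel_right _ _ (f (polyO m))]
  exact (norm_sub_le_max_norm _ _).trans (max_le h1 h2)

theorem exists_mem_span_norm_sub_lt (hg : IsDigitFamily g) (f : C(O F, F⸨X⸩)) {ε : ℝ}
    (hε : 0 < ε) : ∃ h ∈ Submodule.span F⸨X⸩ (Set.range (digitProd g)), ‖f - h‖ < ε := by
  have hq : (1 : ℝ) < q F := by exact_mod_cast one_lt_q F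
  have hk : ∀ k : ℕ, ∃ h ∈ Submodule.span F⸨X⸩ (Set.range (digitProd g)),
      ‖f - h‖ ≤ (q F : ℝ)⁻¹ ^ k * ‖f‖ := by
    intro k
    induction k with
    | zero => exact ⟨0, Submodule.zero_mem _, by simp⟩
    | succ k ih =>
      obtain ⟨h, hh, hfh⟩ := ih
      obtain ⟨h', hh', hfh'⟩ := hg.exists_mem_span_norm_sub_le (f - h)
      refine ⟨h + h', Submodule.add_mem _ hh hh', ?_⟩
      rw [← sub_sub, pow_succ', mul_assoc]
      exact hfh'.trans (by gcongr)
  have hlim : Tendsto (fun k : ℕ => (q F : ℝ)⁻¹ ^ k * ‖f‖) atTop (𝓝 0) := by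
    simpa using (tendsto_pow_atTop_nhds_zero_of_lt_one (by positivity)
      (inv_lt_one_of_one_lt₀ hq)).mul_const ‖f‖
  obtain ⟨k, hk'⟩ := (hlim.eventually (gt_mem_nhds hε)).exists
  obtain ⟨h, hh, hfh⟩ := hk k
  exact ⟨h, hh, hfh.trans_lt hk'⟩

theorem exists_expansion_of_mem_span (hg : IsDigitFamily g) {h : C(O F, F⸨X⸩)}
    (hh : h ∈ Submodule.span F⸨X⸩ (Set.range (digitProd g))) :
    ∃ N₀, (∀ j ≥ N₀, coeffFunctional g j j h = 0) ∧
      ∀ N ≥ N₀, ∑ j ∈ range N, coeffFunctional g j j h • digitProd g j = h := by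
  induction hh using Submodule.span_induction with
  | mem x hx =>
    obtain ⟨k, rfl⟩ := hx
    simp only [fun j => hg.coeffFunctional_digitProd (Nat.lt_pow_self (n := j) (one_lt_q F)) k]
    refine ⟨k + 1, fun j hj => if_neg (by omega), fun N hN => ?_⟩
    simp only [ite_smul, one_smul, zero_smul, sum_ite_eq', mem_range]
    exact if_pos (by omega)
  | zero => exact ⟨0, by simp, by simp⟩
  | add x y _ _ hx hy =>
    obtain ⟨N, h1, h2⟩ := hx
    obtain ⟨N', h1', h2'⟩ := hy
    refine ⟨max N N', fun j hj => ?_, fun M hM => ?_⟩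
    · rw [map_add, h1 j (le_of_max_le_left hj), h1' j (le_of_max_le_right hj), add_zero]
    · simp only [map_add, add_smul, sum_add_distrib]
      rw [h2 M (le_of_max_le_left hM), h2' M (le_of_max_le_right hM)]
  | smul c x _ hx =>
    obtain ⟨N, h1, h2⟩ := hx
    refine ⟨N, fun j hj => by rw [map_smul, h1 j hj, smul_zero], fun M hM => ?_⟩
    simp only [map_smul, smul_assoc]
    rw [← smul_sum, h2 M hM]

/-- Every continuous function has an expansion: the partial sum operators are contractions which
are eventually the identity on the dense span of the products. -/
theorem exists_hasExpansion (hg : IsDigitFamily g) (f : C(O F, F⸨X⸩)) :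
    Tendsto (fun j => coeffFunctional g j j f) atTop (𝓝 0) ∧
      HasExpansion (digitProd g) (fun j => coeffFunctional g j j f) f := by
  constructor
  · rw [Metric.tendsto_atTop]
    intro ε hε
    obtain ⟨h, hh, hfh⟩ := hg.exists_mem_span_norm_sub_lt f hε
    obtain ⟨N₀, h0, -⟩ := hg.exists_expansion_of_mem_span hh
    refine ⟨N₀, fun j hj => ?_⟩
    have h1 : coeffFunctional g j j f = coeffFunctional g j j (f - h) := by
      rw [map_sub, h0 j hj, sub_zero]
    rw [dist_zero_right, h1]
    exact (hg.norm_coeffFunctional_le _ _ _).trans_lt hfh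
  · rw [HasExpansion, Metric.tendsto_atTop]
    intro ε hε
    obtain ⟨h, hh, hfh⟩ := hg.exists_mem_span_norm_sub_lt f (half_pos hε)
    obtain ⟨N₀, -, h0⟩ := hg.exists_expansion_of_mem_span hh
    refine ⟨N₀, fun N hN => ?_⟩
    have h1 : ∑ j ∈ range N, coeffFunctional g j j f • digitProd g j - f =
        ∑ j ∈ range N, coeffFunctional g j j (f - h) • digitProd g j - (f - h) := by
      simp only [map_sub, sub_smul, sum_sub_distrib]
      rw [h0 N hN]
      abel
    rw [dist_eq_norm, h1]
    have h2 := hg.norm_sum_smul_digitProd_apply_le (norm_nonneg (f - h)) (N := N)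
      (b := fun j => coeffFunctional g j j (f - h)) fun j _ => hg.norm_coeffFunctional_le _ _ _
    linarith [norm_sub_le (∑ j ∈ range N, coeffFunctional g j j (f - h) • digitProd g j) (f - h)]

theorem isOrthonormalBasis_digitProd (hg : IsDigitFamily g) :
    IsOrthonormalBasis F⸨X⸩ (digitProd g) where
  existsUnique_expansion f :=
    ⟨_, hg.exists_hasExpansion f, fun _ hB => funext fun j =>
      hg.eq_coeffFunctional_of_hasExpansion hB.2 (Nat.lt_pow_self (one_lt_q F))⟩
  norm_eq_max f B hB0 hB := by
    have hle : ∀ j, ‖B j‖ ≤ ‖f‖ := fun j => by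
      rw [hg.eq_coeffFunctional_of_hasExpansion hB (Nat.lt_pow_self (n := j) (one_lt_q F))]
      exact hg.norm_coeffFunctional_le _ _ _
    obtain ⟨j₀, hj₀⟩ : ∃ j₀, ∀ j, ‖B j‖ ≤ ‖B j₀‖ := by
      by_cases h0 : ∀ j, B j = 0
      · exact ⟨0, fun j => by rw [h0, h0]⟩
      · push Not at h0
        obtain ⟨k, hk⟩ := h0
        obtain ⟨N, hN⟩ := Metric.tendsto_atTop.mp hB0 ‖B k‖ (norm_pos_iff.mpr hk)
        obtain ⟨j₀, -, hj₀⟩ := (range (max N k + 1)).exists_max_image (fun j => ‖B j‖) ⟨0, by simp⟩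
        refine ⟨j₀, fun j => ?_⟩
        rcases lt_or_ge j (max N k + 1) with hj | hj
        · exact hj₀ j (mem_range.mpr hj)
        · have h1 := hN j (by omega)
          rw [dist_zero_right] at h1
          exact h1.le.trans (hj₀ k (mem_range.mpr (by omega)))
    have hfle : ‖f‖ ≤ ‖B j₀‖ :=
      le_of_tendsto hB.norm (Eventually.of_forall fun N =>
        hg.norm_sum_smul_digitProd_apply_le (norm_nonneg _) fun j _ => hj₀ j)
    refine ⟨⟨j₀, le_antisymm (hle j₀) hfle⟩, ?_⟩
    rintro _ ⟨j, rfl⟩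
    exact hle j

end IsDigitFamily

end Family

/-! ### Hyper-differential operators -/

section HyperDeriv

variable (F : Type*) [Field F] [Finite F]

theorem isDigitFamily_hyperDeriv : IsDigitFamily (hyperDeriv F) where
  apply_add i x y := map_add (LaurentSeries.hasseDeriv F i) (x : F⸨X⸩) y
  apply_polyO i m hm := by
    ext n
    change (LaurentSeries.hasseDeriv F i ((polyO m : O F) : F⸨X⸩)).coeff n = 0
    rw [LaurentSeries.hasseDeriv_coeff]
    rcases lt_or_ge (n + i) 0 with h | h
    · rw [coeff_of_neg _ h, smul_zero]
    · obtain ⟨k, hk⟩ := Int.eq_ofNat_of_zero_le h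
      rw [hk, polyO_coeff, Ring.choose_natCast]
      rcases lt_or_ge k i with hki | hki
      · rw [Nat.choose_eq_zero_of_lt hki, Nat.cast_zero, zero_smul]
      · rw [Polynomial.coeff_eq_zero_of_degree_lt (hm.trans_le (by exact_mod_cast hki)), smul_zero]
  apply_C_mul_X_pow i a := by
    change LaurentSeries.hasseDeriv F i
      ((polyO (Polynomial.C a * Polynomial.X ^ i) : O F) : F⸨X⸩) = _
    ext n
    rw [LaurentSeries.hasseDeriv_coeff, polyO_C_mul_X_pow, algebraMap_mul_coeff, T_pow_coeff,
      ← mul_one (algebraMap F F⸨X⸩ a), algebraMap_mul_coeff, HahnSeries.coeff_one]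
    rcases eq_or_ne n 0 with rfl | hn
    · simp [Ring.choose_natCast]
    · rw [if_neg (by omega), if_neg hn, mul_zero, smul_zero]
  norm_apply_le i x _ := by
    have hq : (1 : ℝ) < q F := by exact_mod_cast one_lt_q F
    change ‖LaurentSeries.hasseDeriv F i (x : F⸨X⸩)‖ ≤ _
    rcases eq_or_ne (x : F⸨X⸩) 0 with hx | hx
    · simp [hx]
    · rw [norm_eq (x : F⸨X⸩), if_neg hx, ← zpow_natCast, ← zpow_add₀ (by positivity),
        show (i : ℤ) + -(x : F⸨X⸩).order = -((x : F⸨X⸩).order - i) by ring, norm_le_zpow_iff]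
      intro n hn
      rw [LaurentSeries.hasseDeriv_coeff, HahnSeries.coeff_eq_zero_of_lt_order (by omega),
        smul_zero]

end HyperDeriv

/-! ### Carlitz polynomials -/

section Carlitz

theorem prod_sub_algebraMap_mul {F L : Type*} [Field F] [Fintype F] [Field L] [Algebra F L]
    (y d : L) : ∏ a : F, (y - algebraMap F L a * d) = y ^ q F - d ^ (q F - 1) * y := by
  have hq := one_lt_q F
  have h1 : ∀ z : L, ∏ a : F, (z - algebraMap F L a) = z ^ q F - z := by
    intro z
    have h := Polynomial.prod_multiset_X_sub_C_of_monic_of_roots_card_eq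
      (p := (Polynomial.X ^ q F - Polynomial.X : Polynomial F))
      (Polynomial.monic_X_pow_sub (by rw [Polynomial.degree_X]; exact_mod_cast hq))
      (by rw [q, Nat.card_eq_fintype_card, FiniteField.roots_X_pow_card_sub_X,
            FiniteField.X_pow_card_sub_X_natDegree_eq _ Fintype.one_lt_card]; rfl)
    rw [q, Nat.card_eq_fintype_card, FiniteField.roots_X_pow_card_sub_X] at h
    have h2 := congrArg (Polynomial.aeval z) h
    rw [q, Nat.card_eq_fintype_card]
    simpa [Polynomial.aeval_prod, map_prod] using h2
  rcases eq_or_ne d 0 with rfl | hd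
  · rw [zero_pow (by omega)]
    simp
  · have h2 : ∀ a : F, y - algebraMap F L a * d = d * (y / d - algebraMap F L a) := by
      intro a
      field_simp
    have h3 : d ^ q F = d ^ (q F - 1) * d := by rw [← pow_succ]; congr 1; omega
    simp only [h2, prod_mul_distrib, h1, prod_const, card_univ]
    rw [← Nat.card_eq_fintype_card, div_pow, mul_sub, mul_div_cancel₀ _ (pow_ne_zero _ hd)]
    congr 1
    rw [← q, h3]
    field_simp

theorem carlitzF_succ (F : Type*) [Field F] (n : ℕ) :
    carlitzF F (n + 1) = bracket F (n + 1) * carlitzF F n ^ q F := by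
  rw [carlitzF, prod_range_succ', carlitzF, ← prod_pow, mul_comm]
  congr 1
  · simp
  · refine prod_congr rfl fun i _ => ?_
    rw [← pow_mul, ← pow_succ, Nat.add_sub_add_right]

variable {F : Type*} [Field F] [Finite F]

theorem add_pow_q (x y : F⸨X⸩) : (x + y) ^ q F = x ^ q F + y ^ q F := by
  have := Fintype.ofFinite F
  have h := map_add (FiniteField.frobeniusAlgHom F F⸨X⸩) x y
  simpa only [FiniteField.coe_frobeniusAlgHom, q, Nat.card_eq_fintype_card] using h

theorem sub_pow_q (x y : F⸨X⸩) : (x - y) ^ q F = x ^ q F - y ^ q F := by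
  rw [eq_sub_iff_add_eq, ← add_pow_q, sub_add_cancel]

theorem eval_carlitzLittleE (n : ℕ) (x : F⸨X⸩) :
    (carlitzLittleE F n).eval x = ∏ m ∈ polysLT F n, (x - ((polyO m : O F) : F⸨X⸩)) := by
  simp [carlitzLittleE, Polynomial.eval_prod]

theorem eval_carlitzLittleE_zero (x : F⸨X⸩) : (carlitzLittleE F 0).eval x = x := by
  have h : ((polyO (0 : Polynomial F) : O F) : F⸨X⸩) = 0 := by simp [polyO]
  rw [eval_carlitzLittleE, polysLT_zero, prod_singleton, h, sub_zero]

theorem eval_carlitzLittleE_succ_eq_prod [Fintype F] (n : ℕ) (x : F⸨X⸩) :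
    (carlitzLittleE F (n + 1)).eval x =
      ∏ a : F, (carlitzLittleE F n).eval (x - algebraMap F F⸨X⸩ a * T F ^ n) := by
  rw [eval_carlitzLittleE, prod_polysLT_succ]
  refine prod_congr rfl fun a _ => ?_
  rw [eval_carlitzLittleE]
  refine prod_congr rfl fun m _ => ?_
  rw [polyO_add, Subring.coe_add, polyO_C_mul_X_pow]
  ring

/-- If `eₙ` is `F`-linear, the product over the top coefficient is a product over an `F`-line. -/
theorem eval_carlitzLittleE_succ_of_linear {n : ℕ}
    (hadd : ∀ x y, (carlitzLittleE F n).eval (x + y) =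
      (carlitzLittleE F n).eval x + (carlitzLittleE F n).eval y)
    (hmul : ∀ (a : F) (x : F⸨X⸩), (carlitzLittleE F n).eval (algebraMap F F⸨X⸩ a * x) =
      algebraMap F F⸨X⸩ a * (carlitzLittleE F n).eval x) (x : F⸨X⸩) :
    (carlitzLittleE F (n + 1)).eval x = (carlitzLittleE F n).eval x ^ q F -
      (carlitzLittleE F n).eval (T F ^ n) ^ (q F - 1) * (carlitzLittleE F n).eval x := by
  have := Fintype.ofFinite F
  rw [eval_carlitzLittleE_succ_eq_prod, ← prod_sub_algebraMap_mul (F := F)]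
  refine prod_congr rfl fun a _ => ?_
  rw [← hmul, eq_sub_iff_add_eq, ← hadd, sub_add_cancel]

theorem eval_carlitzLittleE_linear (n : ℕ) :
    (∀ x y, (carlitzLittleE F n).eval (x + y) =
      (carlitzLittleE F n).eval x + (carlitzLittleE F n).eval y) ∧
    ∀ (a : F) (x : F⸨X⸩), (carlitzLittleE F n).eval (algebraMap F F⸨X⸩ a * x) =
      algebraMap F F⸨X⸩ a * (carlitzLittleE F n).eval x := by
  induction n with
  | zero => simp [eval_carlitzLittleE_zero]
  | succ n ih =>
    have hr := eval_carlitzLittleE_succ_of_linear ih.1 ih.2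
    refine ⟨fun x y => ?_, fun a x => ?_⟩
    · rw [hr, hr, hr, ih.1, add_pow_q]
      ring
    · have := Fintype.ofFinite F
      have ha : a ^ q F = a := by rw [q, Nat.card_eq_fintype_card, FiniteField.pow_card]
      rw [hr, hr, ih.2, mul_pow, ← map_pow, ha]
      ring

theorem eval_carlitzLittleE_succ (n : ℕ) (x : F⸨X⸩) :
    (carlitzLittleE F (n + 1)).eval x = (carlitzLittleE F n).eval x ^ q F -
      (carlitzLittleE F n).eval (T F ^ n) ^ (q F - 1) * (carlitzLittleE F n).eval x :=
  eval_carlitzLittleE_succ_of_linear (eval_carlitzLittleE_linear n).1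
    (eval_carlitzLittleE_linear n).2 x

theorem eval_carlitzLittleE_polyO {n : ℕ} {m : Polynomial F} (hm : m.degree < n) :
    (carlitzLittleE F n).eval ((polyO m : O F) : F⸨X⸩) = 0 := by
  rw [eval_carlitzLittleE]
  exact prod_eq_zero ((mem_polysLT F).mpr hm) (sub_self _)

/-- Carlitz's identity `eₙ₊₁(Tx) = T eₙ₊₁(x) + [n+1] eₙ(x) ^ q`, proved along with its consequence
`eₙ(Tⁿ) = Fₙ`. -/
theorem eval_carlitzLittleE_T_mul_and_T_pow (n : ℕ) :
    (∀ x, (carlitzLittleE F (n + 1)).eval (T F * x) = T F * (carlitzLittleE F (n + 1)).eval x +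
      bracket F (n + 1) * (carlitzLittleE F n).eval x ^ q F) ∧
    (carlitzLittleE F n).eval (T F ^ n) = carlitzF F n := by
  have hq := one_lt_q F
  induction n with
  | zero =>
    have h0 : (carlitzLittleE F 0).eval (T F ^ 0) = carlitzF F 0 := by
      simp [eval_carlitzLittleE_zero, carlitzF]
    refine ⟨fun x => ?_, h0⟩
    simp only [eval_carlitzLittleE_succ, h0, eval_carlitzLittleE_zero, carlitzF, range_zero,
      prod_empty, one_pow, bracket, zero_add, pow_one]
    ring
  | succ n ih =>
    obtain ⟨hT, hF⟩ := ih
    have hF' : (carlitzLittleE F (n + 1)).eval (T F ^ (n + 1)) = carlitzF F (n + 1) := by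
      rw [pow_succ', hT, hF, ← polyO_X_pow, eval_carlitzLittleE_polyO, mul_zero, zero_add,
        carlitzF_succ]
      rw [Polynomial.degree_X_pow]
      exact_mod_cast Nat.lt_succ_self n
    refine ⟨fun x => ?_, hF'⟩
    rw [eval_carlitzLittleE_succ (n + 1), eval_carlitzLittleE_succ (n + 1), hF', hT, add_pow_q,
      mul_pow, mul_pow]
    have h1 : (carlitzLittleE F (n + 1)).eval x ^ q F = ((carlitzLittleE F n).eval x ^ q F) ^ q F -
        (carlitzF F n ^ q F) ^ (q F - 1) * (carlitzLittleE F n).eval x ^ q F := by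
      rw [eval_carlitzLittleE_succ, hF, sub_pow_q, mul_pow, pow_right_comm (carlitzF F n)]
    have h2 : carlitzF F (n + 1) ^ (q F - 1) * bracket F (n + 1) =
        bracket F (n + 1) ^ q F * (carlitzF F n ^ q F) ^ (q F - 1) := by
      rw [carlitzF_succ, mul_pow, mul_right_comm, ← pow_succ, Nat.sub_add_cancel hq.le]
    have h3 : bracket F (n + 1 + 1) = T F ^ q F - T F + bracket F (n + 1) ^ q F := by
      rw [bracket, bracket, sub_pow_q, ← pow_mul, ← pow_succ]
      ring
    rw [h3]
    linear_combination (-(bracket F (n + 1) ^ q F)) * h1 -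
      (carlitzLittleE F n).eval x ^ q F * h2

theorem eval_carlitzLittleE_T_pow (n : ℕ) :
    (carlitzLittleE F n).eval (T F ^ n) = carlitzF F n :=
  (eval_carlitzLittleE_T_mul_and_T_pow n).2

theorem carlitzF_ne_zero (n : ℕ) : carlitzF F n ≠ 0 := by
  rw [← eval_carlitzLittleE_T_pow, eval_carlitzLittleE, prod_ne_zero_iff]
  intro m hm h
  have h1 := congrArg (fun x : F⸨X⸩ => x.coeff n) h
  simp [polyO_coeff, T_pow_coeff,
    Polynomial.coeff_eq_zero_of_degree_lt ((mem_polysLT F).mp hm)] at h1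

theorem norm_T_pow (n : ℕ) : ‖T F ^ n‖ = (q F : ℝ) ^ (-(n : ℤ)) := by
  have h : T F ^ n = HahnSeries.single (n : ℤ) 1 := by
    rw [T, PowerSeries.coe_X, HahnSeries.single_pow, one_pow, nsmul_eq_mul, mul_one]
  rw [norm_eq, h, if_neg (by simp), HahnSeries.order_single one_ne_zero]

/-- Factor by factor, `eₙ` on `Tⁿ O` is bounded by its value at `Tⁿ`, since a nonzero `m` of degree
`< n` has absolute value greater than `‖Tⁿ‖`. -/
theorem norm_eval_carlitzLittleE_le {n : ℕ} {x : F⸨X⸩} (hx : ‖x‖ ≤ (q F : ℝ) ^ (-(n : ℤ))) :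
    ‖(carlitzLittleE F n).eval x‖ ≤ (q F : ℝ) ^ n * ‖x‖ * ‖carlitzF F n‖ := by
  classical
  have hq : (1 : ℝ) < q F := by exact_mod_cast one_lt_q F
  have h0 : (0 : Polynomial F) ∈ polysLT F n := by simp
  have hz : ((polyO (0 : Polynomial F) : O F) : F⸨X⸩) = 0 := by simp [polyO]
  rw [← eval_carlitzLittleE_T_pow, eval_carlitzLittleE, eval_carlitzLittleE, norm_prod, norm_prod,
    ← mul_prod_erase _ _ h0, ← mul_prod_erase _ _ h0, hz, sub_zero, sub_zero, norm_T_pow]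
  have hle : ∏ m ∈ (polysLT F n).erase 0, ‖x - ((polyO m : O F) : F⸨X⸩)‖ ≤
      ∏ m ∈ (polysLT F n).erase 0, ‖T F ^ n - ((polyO m : O F) : F⸨X⸩)‖ := by
    refine prod_le_prod (fun _ _ => norm_nonneg _) fun m hm => ?_
    rw [mem_erase, mem_polysLT] at hm
    have hlt : (q F : ℝ) ^ (-(n : ℤ)) < ‖((polyO m : O F) : F⸨X⸩)‖ := by
      by_contra! hcon
      rw [norm_le_zpow_iff] at hcon
      refine hm.1 (Polynomial.ext fun k => ?_)
      rw [Polynomial.coeff_zero]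
      rcases lt_or_ge k n with hk | hk
      · rw [← polyO_coeff, hcon k (by exact_mod_cast hk)]
      · exact Polynomial.coeff_eq_zero_of_degree_lt (hm.2.trans_le (by exact_mod_cast hk))
    have h1 : ‖((polyO m : O F) : F⸨X⸩)‖ ≤ ‖T F ^ n - ((polyO m : O F) : F⸨X⸩)‖ := by
      have h2 := norm_sub_le_max_norm (T F ^ n) (T F ^ n - ((polyO m : O F) : F⸨X⸩))
      rw [sub_sub_cancel, norm_T_pow] at h2
      exact (le_max_iff.mp h2).resolve_left (not_le.mpr hlt)
    exact (norm_sub_le_max_norm _ _).trans (max_le (hx.trans (hlt.le.trans h1)) h1)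
  have hc : (q F : ℝ) ^ n * (q F : ℝ) ^ (-(n : ℤ)) = 1 := by
    rw [← zpow_natCast, ← zpow_add₀ (by positivity), add_neg_cancel, zpow_zero]
  calc _ ≤ ‖x‖ * ∏ m ∈ (polysLT F n).erase 0, ‖T F ^ n - ((polyO m : O F) : F⸨X⸩)‖ := by gcongr
    _ = ((q F : ℝ) ^ n * (q F : ℝ) ^ (-(n : ℤ))) * (‖x‖ *
        ∏ m ∈ (polysLT F n).erase 0, ‖T F ^ n - ((polyO m : O F) : F⸨X⸩)‖) := by rw [hc, one_mul]
    _ = _ := by ring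

variable (F)

/-- The polynomial `Eₙ` as a continuous function `O → K`. -/
noncomputable def carlitzEFun (n : ℕ) : C(O F, F⸨X⸩) where
  toFun x := (carlitzE F n).eval (x : F⸨X⸩)
  continuous_toFun := (carlitzE F n).continuous.comp continuous_subtype_val

theorem carlitzEFun_apply (n : ℕ) (x : O F) :
    carlitzEFun F n x = (carlitzF F n)⁻¹ * (carlitzLittleE F n).eval (x : F⸨X⸩) := by
  simp [carlitzEFun, carlitzE]

theorem isDigitFamily_carlitzEFun : IsDigitFamily (carlitzEFun F) where
  apply_add i x y := by
    simp only [carlitzEFun_apply, Subring.coe_add, (eval_carlitzLittleE_linear i).1, mul_add]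
  apply_polyO i m hm := by rw [carlitzEFun_apply, eval_carlitzLittleE_polyO hm, mul_zero]
  apply_C_mul_X_pow i a := by
    rw [carlitzEFun_apply, polyO_C_mul_X_pow, (eval_carlitzLittleE_linear i).2,
      eval_carlitzLittleE_T_pow, mul_left_comm, inv_mul_cancel₀ (carlitzF_ne_zero i), mul_one]
  norm_apply_le i x hx := by
    rw [carlitzEFun_apply, norm_mul, norm_inv, inv_mul_le_iff₀ (norm_pos_iff.mpr
      (carlitzF_ne_zero i)), mul_comm ‖carlitzF F i‖]
    exact norm_eval_carlitzLittleE_le hx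

theorem carlitzGFun_eq_digitProd : carlitzGFun F = digitProd (carlitzEFun F) := by
  funext j
  refine ContinuousMap.ext fun x => ?_
  rw [digitProd, ContinuousMap.prod_apply]
  exact (Polynomial.eval_prod _ _ _).trans (prod_congr rfl fun i _ => Polynomial.eval_pow _)

end Carlitz

end CarlitzBases

theorem theorem7 (F : Type*) [Field F] [Finite F] :
    (IsOrthonormalBasis F⸨X⸩ (carlitzGFun F) ∧ IsOrthonormalBasis F⸨X⸩ (digitDeriv F)) ∧
    ∀ (f : C(O F, F⸨X⸩)) (B : ℕ → F⸨X⸩), HasExpansion (digitDeriv F) B f →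
      ∀ j n : ℕ, j < q F ^ n →
        B j = (-1) ^ n *
          ∑ m ∈ polysLT F n, digitDeriv' F (q F ^ n - 1 - j) (polyO m) * f (polyO m) := by
  refine ⟨⟨?_, (isDigitFamily_hyperDeriv F).isOrthonormalBasis_digitProd⟩, ?_⟩
  · rw [carlitzGFun_eq_digitProd]
    exact (isDigitFamily_carlitzEFun F).isOrthonormalBasis_digitProd
  · exact fun f B hB j n hj =>
      (isDigitFamily_hyperDeriv F).eq_coeffFunctional_of_hasExpansion hB hj
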